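/- Let $G$ be a finite group acting transitively on a finite set $X$, let $x_0 \in X$, and let $K \le G$ be the stabilizer of $x_0$ (so that $X \cong G/K$). Let $L(X)$ be the space of functions $X \to \mathbb{C}$, on which $G$ acts by $(\lambda(g)f)(x) = f(g^{-1}x)$. Suppose that $(G,K)$ is a Gelfand pair, that is, $L(G/K)$ is a direct sum of pairwise inequivalent irreducible representations, and let $L(X) \cong \bigoplus_{\rho \in I} V_\rho$ be the decomposition into irreducible unitary representations $(\rho, V_\rho)$ of $G$; put $d_\rho = \dim V_\rho$. For $\rho\in I$ the spherical function is $\phi_\rho(g) = \langle v_\rho, \rho(g)v_\rho\rangle$ for $g \in G$, where $\langle\cdot,\cdot\rangle$ is the scalar product of $V_\rho$, linear in the first argument, and $v_\rho \in V_\rho$ is a unit vector with $\rho(k)v_\rho = v_\rho$ for all $k \in K$; such a $v_\rho$ exists, and $\phi_\rho$ does not depend on its choice. Let $\tau : G \to G$ be an involutory anti-automorphism: $\tau(gh) = \tau(h)\tau(g)$ and $\tau(\tau(g)) = g$ for all $g,h \in G$; it is not assumed that $\tau(K) = K$. For a finite-dimensional representation $(\rho,V)$ of $G$ let $\rho^\tau$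 be the representation of $G$ on the dual space $V'$ given by $\rho^\tau(g) = \rho(\tau(g))^T$, where $T$ denotes the transpose, and let $$C_\tau(\rho) = \dim \mathrm{Hom}_G^{\mathrm{Sym}}(\rho^\tau,\rho) - \dim \mathrm{Hom}_G^{\mathrm{Skew}}(\rho^\tau,\rho),$$ where $\mathrm{Hom}_G^{\mathrm{Sym}}(\rho^\tau,\rho)$ and $\mathrm{Hom}_G^{\mathrm{Skew}}(\rho^\tau,\rho)$ are the spaces of linear maps $A : V' \to V$ with $A\rho^\tau(g) = \rho(g)A$ for all $g \in G$ and $A^T = A$, respectively $A^T = -A$ (with $V'' = V$). For $x \in X$ let $\zeta_\tau(x) = |\{g \in G : \tau(g)^{-1}g x_0 = x\}|$. Then: (1) For every $\rho \in I$, $$\frac{d_\rho}{|G|} \sum_{g \in G} \phi_\rho(\tau(g)^{-1}g) = C_\tau(\rho).$$ (2) Writing $\sim$ for equivalence of representations, $$\frac{1}{|G|} \sum_{x \in X} \zeta_\tau(x)^2 = |K| \sum_{\substack{\rho \in I \\ \rho \sim \rho^\tau}} \frac{1}{d_\rho}.$$ -/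

import Mathlib

namespace TwistedFS

section AntiAutomorphism

/-- `τ` is an involutory anti-automorphism of the group `G`; bijectivity follows from
`τ (τ g) = g`. -/
structure IsInvolutoryAntiAut {G : Type*} [Group G] (τ : G → G) : Prop where
  map_mul : ∀ g h : G, τ (g * h) = τ h * τ g
  involutive : ∀ g : G, τ (τ g) = g

theorem IsInvolutoryAntiAut.map_one {G : Type*} [Group G] {τ : G → G}
    (hτ : IsInvolutoryAntiAut τ) : τ 1 = 1 := by
  have h := hτ.map_mul 1 1
  rw [mul_one] at h
  exact left_eq_mul.mp h

/-- For a basepoint `x₀`, the number `ζ_τ(x)` of elements `g` of `G` with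
`τ(g)⁻¹ g x₀ = x`. -/
noncomputable def zeta {G X : Type*} [Group G] [MulAction G X] (τ : G → G) (x₀ x : X) : ℕ :=
  Nat.card {g : G // ((τ g)⁻¹ * g) • x₀ = x}

end AntiAutomorphism

section Conjugate

variable {G V : Type*} [Group G] [AddCommGroup V] [Module ℂ V]

/-- The `τ`-conjugate representation `ρ^τ` on the dual space: `ρ^τ(g) = ρ(τ(g))ᵀ`. -/
def tauConj {τ : G → G} (hτ : IsInvolutoryAntiAut τ) (ρ : Representation ℂ G V) :
    Representation ℂ G (Module.Dual ℂ V) where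
  toFun g := (ρ (τ g)).dualMap
  map_one' := by
    rw [hτ.map_one, _root_.map_one]
    exact LinearMap.dualMap_id
  map_mul' g h := by
    rw [hτ.map_mul, _root_.map_mul]
    exact (LinearMap.dualMap_comp_dualMap (ρ (τ g)) (ρ (τ h))).symm

/-- The space of intertwiners `A : V' → V` from `ρ^τ` to `ρ` that satisfy `A = ε Aᵀ`. Here
`Aᵀ : V' → V''` is `A.dualMap`, and `V` is mapped to its bidual by the canonical map. -/
def homEps {τ : G → G} (hτ : IsInvolutoryAntiAut τ) (ρ : Representation ℂ G V) (ε : ℂ) :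
    Submodule ℂ (Module.Dual ℂ V →ₗ[ℂ] V) where
  carrier := {A | (∀ g : G, A ∘ₗ tauConj hτ ρ g = ρ g ∘ₗ A) ∧
    Module.Dual.eval ℂ V ∘ₗ A = ε • A.dualMap}
  zero_mem' := by
    refine ⟨fun g => by simp, ?_⟩
    ext u w
    simp
  add_mem' := by
    rintro A B ⟨hA, hA'⟩ ⟨hB, hB'⟩
    refine ⟨fun g => by rw [LinearMap.add_comp, hA, hB, LinearMap.comp_add], ?_⟩
    rw [LinearMap.comp_add, hA', hB']
    ext u w
    simp [mul_add]
  smul_mem' := by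
    rintro c A ⟨hA, hA'⟩
    refine ⟨fun g => by rw [LinearMap.smul_comp, hA, LinearMap.comp_smul], ?_⟩
    rw [LinearMap.comp_smul, hA']
    ext u w
    simp [mul_left_comm]

/-- The symmetric intertwiners from `ρ^τ` to `ρ`. -/
def homSym {τ : G → G} (hτ : IsInvolutoryAntiAut τ) (ρ : Representation ℂ G V) :
    Submodule ℂ (Module.Dual ℂ V →ₗ[ℂ] V) := homEps hτ ρ 1

/-- The antisymmetric intertwiners from `ρ^τ` to `ρ`. -/
def homSkew {τ : G → G} (hτ : IsInvolutoryAntiAut τ) (ρ : Representation ℂ G V) :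
    Submodule ℂ (Module.Dual ℂ V →ₗ[ℂ] V) := homEps hτ ρ (-1)

/-- The `τ`-Frobenius–Schur number `C_τ(ρ)`. -/
noncomputable def frobeniusSchur {τ : G → G} (hτ : IsInvolutoryAntiAut τ)
    (ρ : Representation ℂ G V) : ℤ :=
  (Module.finrank ℂ (homSym hτ ρ) : ℤ) - (Module.finrank ℂ (homSkew hτ ρ) : ℤ)

end Conjugate

section Gelfand

/-- The permutation representation on `L(X)`, the space of functions `X → ℂ`:
`(λ(g) f)(x) = f(g⁻¹ x)`. -/
def permRep (G X : Type*) [Group G] [MulAction G X] : Representation ℂ G (X → ℂ) where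
  toFun g := LinearMap.funLeft ℂ ℂ (fun x : X => g⁻¹ • x)
  map_one' := by
    ext f x
    simp [LinearMap.funLeft_apply]
  map_mul' g h := by
    refine LinearMap.ext fun f => funext fun x => ?_
    simp [LinearMap.funLeft_apply, mul_smul]

/-- `σ` is a (finite) direct sum of pairwise inequivalent irreducible subrepresentations. -/
def IsMultiplicityFree {G W : Type*} [Group G] [AddCommGroup W] [Module ℂ W]
    (σ : Representation ℂ G W) : Prop :=
  ∃ (n : ℕ) (U : Fin n → Subrepresentation σ),
    DirectSum.IsInternal (fun i => (U i).toSubmodule) ∧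
    (∀ i, (U i).toRepresentation.IsIrreducible) ∧
    ∀ i j, i ≠ j → IsEmpty ((U i).toRepresentation.Equiv (U j).toRepresentation)

/-- `(G, K)` is a Gelfand pair: the permutation representation on `L(G/K)` decomposes
without multiplicity. -/
def IsGelfandPair {G : Type*} [Group G] (K : Subgroup G) : Prop :=
  IsMultiplicityFree (permRep G (G ⧸ K))

variable {G V : Type*} [Group G] [NormedAddCommGroup V] [InnerProductSpace ℂ V]

/-- All operators `ρ(g)` preserve the hermitian scalar product. -/
def IsUnitaryRep (ρ : Representation ℂ G V) : Prop :=
  ∀ (g : G) (v w : V), inner ℂ (ρ g v) (ρ g w) = inner ℂ v w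

/-- `φ` is the spherical function `g ↦ ⟨v, ρ(g) v⟩` of some `K`-fixed unit vector `v`. In the
convention used here `⟨·,·⟩` is linear in its first argument, so that `⟨a, b⟩` is `inner ℂ b a`. -/
def IsSphericalFunction (K : Subgroup G) (ρ : Representation ℂ G V) (φ : G → ℂ) : Prop :=
  ∃ v : V, ‖v‖ = 1 ∧ (∀ k ∈ K, ρ k v = v) ∧ ∀ g : G, φ g = inner ℂ (ρ g v) v

end Gelfand

end TwistedFS

/-! Replacing `g` by `τ(h)⁻¹ g h⁻¹` conjugates `τ(g)⁻¹ g` by `h`. Hence `T = ∑ ρ(τ(g)⁻¹ g)` commutes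
with `ρ`, and Schur's lemma makes it a scalar when `ρ` is irreducible.

The trace of `T` is `|G| C_τ(ρ)`. Averaging over `G` projects `Hom(V', V)` onto the intertwiners and
commutes with transposition, so `C_τ(ρ)` is the trace of averaging composed with transposition, and
a matrix-unit computation gives `tr(ρ(g) ρ(τ(g))⁻¹)` for each summand. So `T = |G| C_τ(ρ)/d_ρ`, and
pairing `T v` with the unit vector `v` gives (1). The Gelfand property makes `v` unique up to a
phase.

For (2), `∑ ζ_τ²` counts pairs `(g, h)` for which `τ(g)⁻¹ g τ(h)⁻¹ h` fixes `x₀`. The count is the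
same at every base point, so `|X|` times it is the trace of `T²` on `L(X)`, namely `|G|² ∑
C_τ(ρ)²/d_ρ`. Schur's lemma gives `C_τ(ρ)² = 1` if `ρ ∼ ρ^τ` and `0` otherwise, and `|X| |K| = |G|`.
-/

namespace TwistedFS

/-! ### Transposition on `Hom(V', V)` and its twisted trace -/

section Transpose

variable {V : Type*} [AddCommGroup V] [Module ℂ V] [FiniteDimensional ℂ V]

/-- The transpose of a linear map `V' → V`, where `V''` is identified with `V`. -/
noncomputable def bidualTranspose :
    (Module.Dual ℂ V →ₗ[ℂ] V) →ₗ[ℂ] (Module.Dual ℂ V →ₗ[ℂ] V) where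
  toFun A := (Module.evalEquiv ℂ V).symm.toLinearMap ∘ₗ A.dualMap
  map_add' A B := by
    ext u
    apply (Module.evalEquiv ℂ V).injective
    ext w
    simp
  map_smul' c A := by
    ext u
    apply (Module.evalEquiv ℂ V).injective
    ext w
    simp

@[simp]
theorem apply_bidualTranspose (A : Module.Dual ℂ V →ₗ[ℂ] V) (u w : Module.Dual ℂ V) :
    u (bidualTranspose A w) = w (A u) := by
  simp [bidualTranspose]

theorem dual_to_self_ext {A B : Module.Dual ℂ V →ₗ[ℂ] V}
    (h : ∀ u w : Module.Dual ℂ V, u (A w) = u (B w)) : A = B := by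
  ext w
  apply (Module.evalEquiv ℂ V).injective
  ext u
  simpa using h u w

theorem bidualTranspose_involutive (A : Module.Dual ℂ V →ₗ[ℂ] V) :
    bidualTranspose (bidualTranspose A) = A :=
  dual_to_self_ext fun u w => by simp

theorem eval_comp_eq_smul_dualMap_iff (A : Module.Dual ℂ V →ₗ[ℂ] V) (ε : ℂ) :
    Module.Dual.eval ℂ V ∘ₗ A = ε • A.dualMap ↔ A = ε • bidualTranspose A := by
  constructor
  · intro h
    refine dual_to_self_ext fun u w => ?_
    simpa using LinearMap.congr_fun (LinearMap.congr_fun h w) u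
  · intro h
    ext w u
    simpa using congrArg (fun B : Module.Dual ℂ V →ₗ[ℂ] V => u (B w)) h

/-- The trace of `A ↦ P Aᵀ Qᵀ` on the linear maps `V' → V` is the trace of `P Q`. -/
theorem trace_comp_bidualTranspose_comp (P Q : V →ₗ[ℂ] V)
    (Φ : (Module.Dual ℂ V →ₗ[ℂ] V) →ₗ[ℂ] (Module.Dual ℂ V →ₗ[ℂ] V))
    (hΦ : ∀ A, Φ A = P ∘ₗ bidualTranspose A ∘ₗ Q.dualMap) :
    LinearMap.trace ℂ _ Φ = LinearMap.trace ℂ V (P ∘ₗ Q) := by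
  classical
  let b := Module.finBasis ℂ V
  have hE : ∀ i j (u : Module.Dual ℂ V), (b.dualBasis.linearMap b) (i, j) u = u (b j) • b i := by
    intro i j u
    have : (b.dualBasis.linearMap b) (i, j) =
        LinearMap.toSpanSingleton ℂ V (b i) ∘ₗ Module.Dual.eval ℂ V (b j) := by
      refine b.dualBasis.ext fun k => ?_
      rw [Module.Basis.linearMap_apply_apply]
      simp only [LinearMap.comp_apply, Module.Dual.eval_apply, LinearMap.toSpanSingleton_apply,
        Module.Basis.dualBasis_apply_self]
      rcases eq_or_ne j k with h | h <;> simp [h]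
    rw [this]
    simp
  rw [LinearMap.trace_eq_matrix_trace ℂ (b.dualBasis.linearMap b),
    LinearMap.trace_eq_matrix_trace ℂ b, LinearMap.toMatrix_comp b b b, Matrix.trace,
    Matrix.trace, Fintype.sum_prod_type]
  refine Finset.sum_congr rfl fun i _ => ?_
  rw [Matrix.diag_apply, Matrix.mul_apply]
  refine Finset.sum_congr rfl fun j _ => ?_
  have hc : ∀ v k, b.repr v k = b.dualBasis k v := fun v k => by simp
  simp only [Matrix.diag_apply, LinearMap.toMatrix_apply, Module.Basis.linearMap,
    Module.Basis.map_repr, LinearEquiv.trans_apply, LinearEquiv.symm_symm] 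
  have h2 : ∀ A : Module.Dual ℂ V →ₗ[ℂ] V, (Matrix.stdBasis ℂ _ _).repr
      (LinearMap.toMatrix b.dualBasis b A) (i, j) = b.dualBasis i (A (b.dualBasis j)) := by
    intro A
    rw [← hc, ← LinearMap.toMatrix_apply]
    rfl
  rw [h2, hΦ]
  have h3 := hE i j (P.dualMap (b.dualBasis i))
  rw [Module.Basis.linearMap] at h3
  -- Transposition moves the matrix unit `E_ij` onto `Pᵀ b_i*`, so the diagonal entry is `P_ij
  -- Q_ji`.
  change P.dualMap (b.dualBasis i) (bidualTranspose _ (Q.dualMap (b.dualBasis j))) = _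
  rw [apply_bidualTranspose, h3]
  simp

end Transpose

/-! ### Symmetries of the map `g ↦ τ(g)⁻¹ g` -/

section Twist

variable {G : Type*} [Group G] {τ : G → G}

theorem IsInvolutoryAntiAut.map_inv (hτ : IsInvolutoryAntiAut τ) (g : G) : τ g⁻¹ = (τ g)⁻¹ := by
  rw [eq_inv_iff_mul_eq_one, ← hτ.map_mul, mul_inv_cancel, hτ.map_one]

/-- The automorphism `g ↦ τ(g)⁻¹`. -/
def IsInvolutoryAntiAut.invPerm (hτ : IsInvolutoryAntiAut τ) : Equiv.Perm G where
  toFun g := (τ g)⁻¹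
  invFun g := (τ g)⁻¹
  left_inv g := by simp [hτ.map_inv, hτ.involutive]
  right_inv g := by simp [hτ.map_inv, hτ.involutive]

@[simp]
theorem IsInvolutoryAntiAut.invPerm_apply (hτ : IsInvolutoryAntiAut τ) (g : G) :
    hτ.invPerm g = (τ g)⁻¹ := rfl

theorem IsInvolutoryAntiAut.twist_conj (hτ : IsInvolutoryAntiAut τ) (g h : G) :
    (τ ((τ h)⁻¹ * (g * h⁻¹)))⁻¹ * ((τ h)⁻¹ * (g * h⁻¹)) = h * ((τ g)⁻¹ * g) * h⁻¹ := by
  simp only [hτ.map_mul, hτ.map_inv, hτ.involutive]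
  group

theorem IsInvolutoryAntiAut.twist_inv (hτ : IsInvolutoryAntiAut τ) (g : G) :
    (τ (τ g))⁻¹ * τ g = ((τ g)⁻¹ * g)⁻¹ := by
  rw [hτ.involutive]
  group

end Twist

/-! ### The Frobenius–Schur number as a character average -/

section FrobeniusSchur

variable {G V : Type*} [Group G] [Fintype G] [AddCommGroup V] [Module ℂ V]
  [FiniteDimensional ℂ V] {τ : G → G}

omit [Fintype G] in
theorem mem_homEps_iff (hτ : IsInvolutoryAntiAut τ) (ρ : Representation ℂ G V) (ε : ℂ)
    (A : Module.Dual ℂ V →ₗ[ℂ] V) :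
    A ∈ homEps hτ ρ ε ↔ A ∈ ((tauConj hτ ρ).linHom ρ).invariants ∧ A = ε • bidualTranspose A := by
  rw [← eval_comp_eq_smul_dualMap_iff]
  refine and_congr_left' ?_
  rw [Representation.mem_invariants]
  refine forall_congr' fun g => ?_
  rw [Representation.linHom_apply]
  constructor
  · intro h
    rw [← LinearMap.comp_assoc, ← h, LinearMap.comp_assoc, ← Module.End.mul_eq_comp (tauConj hτ ρ g),
      ← map_mul]
    simp [Module.End.one_eq_id]
  · intro h
    conv_lhs => rw [← h]
    rw [LinearMap.comp_assoc, LinearMap.comp_assoc, ← Module.End.mul_eq_comp (tauConj hτ ρ g⁻¹),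
      ← map_mul]
    simp [Module.End.one_eq_id]

-- The transpose of `ρ(g) A ρ(τ(g)⁻¹)ᵀ` is `ρ(τ(g)⁻¹) Aᵀ ρ(g)ᵀ`, which is the action of `τ(g)⁻¹` on
-- `Aᵀ`.
omit [Fintype G] in
theorem bidualTranspose_linHom (hτ : IsInvolutoryAntiAut τ) (ρ : Representation ℂ G V) (g : G)
    (A : Module.Dual ℂ V →ₗ[ℂ] V) :
    bidualTranspose ((tauConj hτ ρ).linHom ρ g A) =
      (tauConj hτ ρ).linHom ρ (hτ.invPerm g) (bidualTranspose A) := by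
  refine dual_to_self_ext fun u w => ?_
  rw [apply_bidualTranspose, Representation.linHom_apply, Representation.linHom_apply]
  have h1 : ∀ h (u : Module.Dual ℂ V), tauConj hτ ρ h u = (ρ (τ h)).dualMap u := fun _ _ => rfl
  simp only [LinearMap.comp_apply, h1]
  have h2 : u ((ρ (hτ.invPerm g)) (bidualTranspose A ((ρ (τ (hτ.invPerm g)⁻¹)).dualMap w))) =
      (ρ (hτ.invPerm g)).dualMap u
        (bidualTranspose A ((ρ (τ (hτ.invPerm g)⁻¹)).dualMap w)) := rfl
  rw [h2, apply_bidualTranspose]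
  simp [hτ.map_inv, hτ.involutive]

/-- The projection of `Hom(V', V)` onto the intertwiners from `ρ^τ` to `ρ`. -/
noncomputable def homProj (hτ : IsInvolutoryAntiAut τ) (ρ : Representation ℂ G V) :
    (Module.Dual ℂ V →ₗ[ℂ] V) →ₗ[ℂ] (Module.Dual ℂ V →ₗ[ℂ] V) :=
  (Fintype.card G : ℂ)⁻¹ • ∑ g : G, (tauConj hτ ρ).linHom ρ g

omit [FiniteDimensional ℂ V] in
theorem isProj_homProj (hτ : IsInvolutoryAntiAut τ) (ρ : Representation ℂ G V) :
    LinearMap.IsProj ((tauConj hτ ρ).linHom ρ).invariants (homProj hτ ρ) := by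
  let _ : Invertible (Fintype.card G : ℂ) := invertibleOfNonzero (by simp)
  have : homProj hτ ρ = ((tauConj hτ ρ).linHom ρ).averageMap := by
    simp [homProj, GroupAlgebra.average, map_sum]
  rw [this]
  exact Representation.isProj_averageMap _

theorem bidualTranspose_homProj (hτ : IsInvolutoryAntiAut τ) (ρ : Representation ℂ G V)
    (A : Module.Dual ℂ V →ₗ[ℂ] V) :
    bidualTranspose (homProj hτ ρ A) = homProj hτ ρ (bidualTranspose A) := by
  simp only [homProj, LinearMap.smul_apply, LinearMap.sum_apply, map_smul, map_sum,
    bidualTranspose_linHom]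
  congr 1
  exact Equiv.sum_comp hτ.invPerm fun g => (tauConj hτ ρ).linHom ρ g (bidualTranspose A)

/-- Transposition is an involution commuting with averaging, so averaging can be composed with the
projection `(1 + ε T)/2` onto its `ε`-eigenspace, where `T` is transposition. -/
theorem isProj_homEps (hτ : IsInvolutoryAntiAut τ) (ρ : Representation ℂ G V) {ε : ℂ}
    (hε : ε * ε = 1) :
    LinearMap.IsProj (homEps hτ ρ ε)
      ((2 : ℂ)⁻¹ • (homProj hτ ρ + ε • homProj hτ ρ ∘ₗ bidualTranspose)) := by
  have hP := isProj_homProj hτ ρ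
  constructor
  · intro A
    rw [mem_homEps_iff]
    refine ⟨?_, ?_⟩
    · exact Submodule.smul_mem _ _ (Submodule.add_mem _ (hP.map_mem A)
        (Submodule.smul_mem _ _ (hP.map_mem _)))
    · simp only [LinearMap.smul_apply, LinearMap.add_apply, LinearMap.comp_apply, map_smul, map_add,
        bidualTranspose_homProj, bidualTranspose_involutive]
      rw [smul_comm ε, smul_add ε, smul_smul ε ε, hε, one_smul, add_comm]
  · intro A hA
    rw [mem_homEps_iff] at hA
    obtain ⟨h1, h2⟩ := hA
    simp only [LinearMap.smul_apply, LinearMap.add_apply, LinearMap.comp_apply]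
    rw [← map_smul, ← h2, hP.map_id A h1, ← two_smul ℂ A, smul_smul]
    norm_num

theorem trace_homProj_comp_bidualTranspose (hτ : IsInvolutoryAntiAut τ)
    (ρ : Representation ℂ G V) :
    LinearMap.trace ℂ _ (homProj hτ ρ ∘ₗ bidualTranspose) =
      (Fintype.card G : ℂ)⁻¹ * ∑ g : G, LinearMap.trace ℂ V (ρ ((τ g)⁻¹ * g)) := by
  rw [homProj, LinearMap.smul_comp, map_smul, smul_eq_mul,
    ← Module.End.mul_eq_comp, Finset.sum_mul, map_sum]
  congr 1
  refine Finset.sum_congr rfl fun g _ => ?_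
  rw [trace_comp_bidualTranspose_comp (ρ g) (ρ (τ g⁻¹)) _ fun A => rfl, hτ.map_inv,
    ← Module.End.mul_eq_comp, LinearMap.trace_mul_comm, ← map_mul]

/-- The `τ`-Frobenius–Schur number is an average of character values. -/
theorem frobeniusSchur_eq_sum_trace (hτ : IsInvolutoryAntiAut τ) (ρ : Representation ℂ G V) :
    (frobeniusSchur hτ ρ : ℂ) =
      (Fintype.card G : ℂ)⁻¹ * ∑ g : G, LinearMap.trace ℂ V (ρ ((τ g)⁻¹ * g)) := by
  have h1 := (isProj_homEps hτ ρ (ε := 1) (by norm_num)).trace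
  have h2 := (isProj_homEps hτ ρ (ε := -1) (by norm_num)).trace
  rw [← trace_homProj_comp_bidualTranspose hτ ρ, frobeniusSchur, homSym, homSkew]
  push_cast
  rw [← h1, ← h2]
  -- In the difference of the two traces the averaging terms cancel and the transposition terms add
  -- up.
  simp only [map_smul, map_add, smul_eq_mul]
  ring

/-- The projections for `ε = 1` and `ε = -1` add up to the averaging projection. -/
theorem finrank_homSym_add_finrank_homSkew (hτ : IsInvolutoryAntiAut τ)
    (ρ : Representation ℂ G V) :
    Module.finrank ℂ (homSym hτ ρ) + Module.finrank ℂ (homSkew hτ ρ) =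
      Module.finrank ℂ ((tauConj hτ ρ).IntertwiningMap ρ) := by
  have h1 := (isProj_homEps hτ ρ (ε := 1) (by norm_num)).trace
  have h2 := (isProj_homEps hτ ρ (ε := -1) (by norm_num)).trace
  have h3 := (isProj_homProj hτ ρ).trace
  rw [← (Representation.invariantsEquivIntertwiningMap (tauConj hτ ρ) ρ).finrank_eq, homSym,
    homSkew]
  have : ((Module.finrank ℂ (homEps hτ ρ 1) + Module.finrank ℂ (homEps hτ ρ (-1)) : ℕ) : ℂ) =
      Module.finrank ℂ ((tauConj hτ ρ).linHom ρ).invariants := by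
    push_cast
    rw [← h1, ← h2, ← h3]
    simp only [map_smul, map_add, smul_eq_mul]
    ring
  exact_mod_cast this

end FrobeniusSchur

/-! ### Schur's lemma and multiplicity one -/

section Schur

variable {G V W : Type*} [Group G] [AddCommGroup V] [Module ℂ V] [FiniteDimensional ℂ V]
  [AddCommGroup W] [Module ℂ W]

theorem exists_eq_smul_id_of_intertwining {ρ : Representation ℂ G V} (hρ : ρ.IsIrreducible)
    (f : ρ.IntertwiningMap ρ) : ∃ c : ℂ, ∀ v, f v = c • v := by
  obtain ⟨c, hc⟩ :=
    (Representation.IsIrreducible.algebraMap_intertwiningMap_bijective_of_isAlgClosed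
      (ρ := ρ)).surjective f
  refine ⟨c, fun v => ?_⟩
  rw [← hc]
  simp

omit [FiniteDimensional ℂ V] in
theorem nontrivial_of_isIrreducible {ρ : Representation ℂ G V} (hρ : ρ.IsIrreducible) :
    Nontrivial V := by
  by_contra h
  rw [not_nontrivial_iff_subsingleton] at h
  refine bot_ne_top (α := Subrepresentation ρ) (SetLike.ext fun v => ?_)
  rw [Subsingleton.elim v 0]
  exact ⟨fun _ => (⊤ : Submodule ℂ V).zero_mem, fun _ => (⊥ : Submodule ℂ V).zero_mem⟩

/-- A multiplicity-free representation contains every irreducible representation at most once. -/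
theorem IsMultiplicityFree.exists_smul_eq {σ : Representation ℂ G W} (hσ : IsMultiplicityFree σ)
    {ρ : Representation ℂ G V} (hρ : ρ.IsIrreducible) {f : ρ.IntertwiningMap σ} (hf : f ≠ 0)
    (f' : ρ.IntertwiningMap σ) : ∃ c : ℂ, f' = c • f := by
  classical
  obtain ⟨n, U, hU, hirr, hne⟩ := hσ
  let e : (DirectSum (Fin n) fun i => (U i).toSubmodule) ≃ₗ[ℂ] W :=
    LinearEquiv.ofBijective (DirectSum.coeLinearMap fun i => (U i).toSubmodule) hU
  have he : ∀ g, e.toLinearMap ∘ₗ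
      Representation.directSum (fun i => (U i).toRepresentation) g = σ g ∘ₗ e.toLinearMap := by
    intro g
    refine DirectSum.linearMap_ext _ fun i => LinearMap.ext fun u => ?_
    simp only [LinearMap.comp_apply, Representation.directSum_apply, DirectSum.lmap_lof,
      LinearEquiv.coe_coe]
    change DirectSum.coeLinearMap _ _ = σ g (DirectSum.coeLinearMap _ _)
    rw [DirectSum.coeLinearMap_lof, DirectSum.coeLinearMap_lof]
    rfl
  let p : ∀ i, σ.IntertwiningMap (U i).toRepresentation := fun i =>
    ⟨DirectSum.component ℂ (Fin n) (fun i => (U i).toSubmodule) i ∘ₗ e.symm.toLinearMap, by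
      intro g
      rw [LinearMap.comp_assoc, LinearEquiv.isIntertwining_symm_isIntertwining he]
      rfl⟩
  have hp : ∀ w w', (∀ i, p i w = p i w') → w = w' := by
    intro w w' h
    apply e.symm.injective
    exact DFinsupp.ext h
  have hex : ∃ j, (p j).comp f ≠ 0 := by
    by_contra! h
    refine hf (Representation.IntertwiningMap.ext (LinearMap.ext fun v => hp _ _ fun i => ?_))
    have := DFunLike.congr_fun (h i) v
    simpa using this
  obtain ⟨j, hj⟩ := hex
  have hjb := (Representation.IsIrreducible.bijective_or_eq_zero ((p j).comp f)).resolve_right hj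
  let E := ((p j).comp f).ofBijective hjb
  -- A nonzero component in `U k` would make both `U k` and `U j` equivalent to `ρ`.
  have hzero : ∀ k, k ≠ j → ∀ f : ρ.IntertwiningMap σ, (p k).comp f = 0 := by
    intro k hk f
    refine (Representation.IsIrreducible.bijective_or_eq_zero ((p k).comp f)).resolve_left
      fun h => ?_
    exact (hne k j hk).false ((((p k).comp f).ofBijective h).symm.trans E)
  obtain ⟨c, hc⟩ := exists_eq_smul_id_of_intertwining hρ
    (E.symm.toIntertwiningMap.comp ((p j).comp f'))
  refine ⟨c, Representation.IntertwiningMap.ext (LinearMap.ext fun v => hp _ _ fun i => ?_)⟩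
  rcases eq_or_ne i j with rfl | hi
  · have := congrArg E (hc v)
    rw [map_smul] at this
    simpa [E] using this
  · have h1 := DFunLike.congr_fun (hzero i hi f') v
    have h2 := DFunLike.congr_fun (hzero i hi (c • f)) v
    exact h1.trans h2.symm

end Schur

/-! ### The twisted sum acts as a scalar -/

section TwistSum

variable {G V : Type*} [Group G] [Fintype G] [AddCommGroup V] [Module ℂ V] {τ : G → G}

/-- The operator `∑ g, ρ(τ(g)⁻¹ g)`. -/
def twistSum (τ : G → G) (ρ : Representation ℂ G V) : V →ₗ[ℂ] V := ∑ g : G, ρ ((τ g)⁻¹ * g)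

theorem IsInvolutoryAntiAut.sum_twist_conj {M : Type*} [AddCommMonoid M]
    (hτ : IsInvolutoryAntiAut τ) (F : G → M) (h : G) :
    ∑ g : G, F (h * ((τ g)⁻¹ * g) * h⁻¹) = ∑ g : G, F ((τ g)⁻¹ * g) := by
  simp only [← hτ.twist_conj]
  exact Equiv.sum_comp ((Equiv.mulRight h⁻¹).trans (Equiv.mulLeft (τ h)⁻¹))
    fun g => F ((τ g)⁻¹ * g)

theorem IsInvolutoryAntiAut.sum_twist_inv {M : Type*} [AddCommMonoid M]
    (hτ : IsInvolutoryAntiAut τ) (F : G → M) :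
    ∑ g : G, F ((τ g)⁻¹ * g)⁻¹ = ∑ g : G, F ((τ g)⁻¹ * g) := by
  simp only [← hτ.twist_inv]
  exact Equiv.sum_comp (Function.Involutive.toPerm τ hτ.involutive) fun g => F ((τ g)⁻¹ * g)

theorem twistSum_comp (hτ : IsInvolutoryAntiAut τ) (ρ : Representation ℂ G V) (h : G) :
    twistSum τ ρ ∘ₗ ρ h = ρ h ∘ₗ twistSum τ ρ := by
  conv_lhs => rw [twistSum, ← hτ.sum_twist_conj _ h]
  rw [twistSum, ← Module.End.mul_eq_comp, ← Module.End.mul_eq_comp, Finset.sum_mul,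
    Finset.mul_sum]
  refine Finset.sum_congr rfl fun g _ => ?_
  rw [← map_mul, ← map_mul, inv_mul_cancel_right]

variable [FiniteDimensional ℂ V]

/-- The sum is an intertwiner, hence a scalar by Schur's lemma; its trace determines the scalar. -/
theorem twistSum_eq_smul (hτ : IsInvolutoryAntiAut τ) {ρ : Representation ℂ G V}
    (hρ : ρ.IsIrreducible) :
    twistSum τ ρ =
      ((Fintype.card G : ℂ) * frobeniusSchur hτ ρ / Module.finrank ℂ V) • LinearMap.id := by
  have := nontrivial_of_isIrreducible hρ
  obtain ⟨c, hc⟩ := exists_eq_smul_id_of_intertwining hρ ⟨twistSum τ ρ, twistSum_comp hτ ρ⟩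
  have hT : twistSum τ ρ = c • LinearMap.id := LinearMap.ext hc
  have hd : (Module.finrank ℂ V : ℂ) ≠ 0 := by
    exact_mod_cast (Module.finrank_pos (R := ℂ) (M := V)).ne'
  have htr : LinearMap.trace ℂ V (twistSum τ ρ) = Fintype.card G * frobeniusSchur hτ ρ := by
    rw [frobeniusSchur_eq_sum_trace, twistSum, map_sum, mul_inv_cancel_left₀ (by simp)]
  rw [hT] at htr ⊢
  rw [map_smul, LinearMap.trace_id, smul_eq_mul] at htr
  rw [← htr, mul_div_cancel_right₀ _ hd]

/-- The square of the `τ`-Frobenius–Schur number of an irreducible representation `ρ` detects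
whether `ρ` and `ρ^τ` are equivalent. -/
theorem frobeniusSchur_sq (hτ : IsInvolutoryAntiAut τ) {ρ : Representation ℂ G V}
    (hρ : ρ.IsIrreducible) [Decidable (Nonempty (ρ.Equiv (tauConj hτ ρ)))] :
    frobeniusSchur hτ ρ ^ 2 = if Nonempty (ρ.Equiv (tauConj hτ ρ)) then 1 else 0 := by
  have hsum := finrank_homSym_add_finrank_homSkew hτ ρ
  rw [frobeniusSchur]
  split_ifs with h
  · obtain ⟨e⟩ := h
    -- An equivalence identifies `Hom_G(ρ^τ, ρ)` with `End_G(ρ)`, of dimension one, so exactly one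
    -- of the symmetric and skew parts is a line.
    let L : (tauConj hτ ρ).IntertwiningMap ρ ≃ₗ[ℂ] ρ.IntertwiningMap ρ :=
      { toFun f := f.comp e.toIntertwiningMap
        invFun f := f.comp e.symm.toIntertwiningMap
        map_add' f f' := rfl
        map_smul' c f := rfl
        left_inv f := by
          refine DFunLike.ext _ _ fun v => ?_
          simp
        right_inv f := by
          refine DFunLike.ext _ _ fun v => ?_
          simp }
    rw [L.finrank_eq, Representation.IsIrreducible.finrank_intertwiningMap_self] at hsum
    obtain ⟨h1, h2⟩ | ⟨h1, h2⟩ := Nat.add_eq_one_iff.mp hsum <;> rw [h1, h2] <;> norm_num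
  · have : Subsingleton ((tauConj hτ ρ).IntertwiningMap ρ) := by
      refine subsingleton_of_forall_eq 0 fun f => ?_
      -- A nonzero intertwiner is onto, hence bijective because `dim V' = dim V`.
      refine (Representation.IsIrreducible.surjective_or_eq_zero f).resolve_left fun hs => h ?_
      have hi : Function.Injective f.toLinearMap :=
        (LinearMap.injective_iff_surjective_of_finrank_eq_finrank
          (Subspace.dual_finrank_eq (K := ℂ) (V := V))).mpr hs
      exact ⟨(f.ofBijective ⟨hi, hs⟩).symm⟩
    rw [Module.finrank_zero_of_subsingleton (M := (tauConj hτ ρ).IntertwiningMap ρ)] at hsum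
    obtain ⟨h1, h2⟩ := Nat.add_eq_zero_iff.mp hsum
    rw [h1, h2]
    norm_num

end TwistSum

/-! ### Traces of direct sums and of permutation representations -/

section Trace

theorem trace_eq_sum_of_equiv_directSum {G W I : Type*} [Group G] [AddCommGroup W] [Module ℂ W]
    [FiniteDimensional ℂ W] [Fintype I] {V : I → Type*} [∀ i, AddCommGroup (V i)]
    [∀ i, Module ℂ (V i)] [∀ i, FiniteDimensional ℂ (V i)] {σ : Representation ℂ G W}
    {ρ : ∀ i, Representation ℂ G (V i)} (e : σ.Equiv (Representation.directSum ρ)) (g : G) :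
    LinearMap.trace ℂ W (σ g) = ∑ i, LinearMap.trace ℂ (V i) (ρ i g) := by
  classical
  have h1 : LinearMap.trace ℂ W (σ g) =
      LinearMap.trace ℂ _ (Representation.directSum ρ g) := by
    rw [← Representation.Equiv.conj_apply_self g e, LinearMap.trace_conj']
  have h2 : Representation.directSum ρ g = ∑ i, DirectSum.lof ℂ I V i ∘ₗ
      (ρ i g ∘ₗ DirectSum.component ℂ I V i) := by
    refine DirectSum.linearMap_ext _ fun j => LinearMap.ext fun v => ?_
    simp only [LinearMap.comp_apply, LinearMap.sum_apply]
    rw [Finset.sum_eq_single j]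
    · simp
    · intro i _ hij
      rw [DirectSum.component.of, dif_neg hij.symm, map_zero, map_zero]
    · simp
  rw [h1, h2, map_sum]
  refine Finset.sum_congr rfl fun i _ => ?_
  rw [LinearMap.trace_comp_comm', LinearMap.comp_assoc]
  congr 1
  ext v
  simp

theorem trace_permRep {G X : Type*} [Group G] [Fintype X] [DecidableEq X] [MulAction G X] (g : G) :
    LinearMap.trace ℂ _ (permRep G X g) = ∑ x : X, if g • x = x then 1 else 0 := by
  rw [LinearMap.trace_eq_matrix_trace ℂ (Pi.basisFun ℂ X), Matrix.trace]
  refine Finset.sum_congr rfl fun x _ => ?_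
  rw [Matrix.diag_apply, LinearMap.toMatrix_apply]
  simp [permRep, LinearMap.funLeft_apply, Pi.single_apply, inv_smul_eq_iff, eq_comm (a := x)]

end Trace

/-! ### Counting the pairs behind `∑ ζ_τ²` -/

section Counting

variable {G X : Type*} [Group G] [Fintype G] [Fintype X] [DecidableEq X] [MulAction G X]
  {τ : G → G}

omit [Fintype X] in
theorem zeta_eq_sum (τ : G → G) (x₀ x : X) :
    zeta τ x₀ x = ∑ g : G, if ((τ g)⁻¹ * g) • x₀ = x then 1 else 0 := by
  rw [zeta, Nat.card_eq_fintype_card, Fintype.card_subtype, Finset.card_filter]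

theorem sum_card_fiber_sq {α : Type*} [Fintype α] (f : α → X) :
    ∑ x : X, (∑ a : α, if f a = x then 1 else 0) ^ 2 =
      ∑ a : α, ∑ b : α, if f a = f b then 1 else 0 := by
  simp only [sq, Finset.sum_mul_sum]
  rw [Finset.sum_comm]
  refine Finset.sum_congr rfl fun a _ => ?_
  rw [Finset.sum_comm]
  refine Finset.sum_congr rfl fun b _ => ?_
  simp [eq_comm]

/-- Two elements `a`, `b` send `x₀` to the same point when `a⁻¹ b` fixes it; the inverse is absorbed
by `g ↦ τ(g)`. -/
theorem sum_zeta_sq (hτ : IsInvolutoryAntiAut τ) (x₀ : X) :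
    ∑ x : X, zeta τ x₀ x ^ 2 = ∑ g : G, ∑ h : G,
      if (((τ g)⁻¹ * g) * ((τ h)⁻¹ * h)) • x₀ = x₀ then 1 else 0 := by
  rw [← hτ.sum_twist_inv fun a => ∑ h : G, if (a * ((τ h)⁻¹ * h)) • x₀ = x₀ then 1 else 0]
  simp only [zeta_eq_sum, sum_card_fiber_sq]
  refine Finset.sum_congr rfl fun g _ => Finset.sum_congr rfl fun h _ => ?_
  refine if_congr ?_ rfl rfl
  rw [mul_smul ((τ g)⁻¹ * g)⁻¹, inv_smul_eq_iff, eq_comm]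

/-- Conjugating both twisted factors by `k` moves the base point to `k x₀`. By transitivity all
points give the same count, and summing over them counts fixed points. -/
theorem card_mul_sum_zeta_sq [MulAction.IsPretransitive G X] (hτ : IsInvolutoryAntiAut τ)
    (x₀ : X) :
    (Fintype.card X : ℂ) * ∑ x : X, (zeta τ x₀ x : ℂ) ^ 2 =
      ∑ g : G, ∑ h : G, LinearMap.trace ℂ _
        (permRep G X (((τ g)⁻¹ * g) * ((τ h)⁻¹ * h))) := by
  have hconst : ∀ x : X, (∑ g : G, ∑ h : G,
      if (((τ g)⁻¹ * g) * ((τ h)⁻¹ * h)) • x = x then 1 else 0) =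
      ∑ x : X, zeta τ x₀ x ^ 2 := by
    intro x
    obtain ⟨k, rfl⟩ := MulAction.exists_smul_eq G x₀ x
    rw [sum_zeta_sq hτ, ← hτ.sum_twist_conj
      (fun a => ∑ h : G, if (a * ((τ h)⁻¹ * h)) • k • x₀ = k • x₀ then 1 else 0) k]
    refine Finset.sum_congr rfl fun g _ => ?_
    rw [← hτ.sum_twist_conj
      (fun a => if (k * ((τ g)⁻¹ * g) * k⁻¹ * a) • k • x₀ = k • x₀ then 1 else 0) k]
    refine Finset.sum_congr rfl fun h _ => ?_
    refine if_congr ?_ rfl rfl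
    have hk : k * ((τ g)⁻¹ * g) * k⁻¹ * (k * ((τ h)⁻¹ * h) * k⁻¹) * k =
        k * (((τ g)⁻¹ * g) * ((τ h)⁻¹ * h)) := by group
    rw [← mul_smul, hk, mul_smul, smul_left_cancel_iff]
  simp only [trace_permRep]
  have : (Fintype.card X : ℕ) * ∑ x : X, zeta τ x₀ x ^ 2 = ∑ g : G, ∑ h : G, ∑ x : X,
      if (((τ g)⁻¹ * g) * ((τ h)⁻¹ * h)) • x = x then 1 else 0 := by
    rw [← smul_eq_mul, ← Finset.card_univ, ← Finset.sum_const, ← Finset.sum_congr rfl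
      fun x _ => hconst x, Finset.sum_comm]
    refine Finset.sum_congr rfl fun g _ => ?_
    rw [Finset.sum_comm]
  exact_mod_cast this

end Counting

/-! ### Spherical functions: existence, uniqueness, twisted average -/

section Spherical

variable {G V : Type*} [Group G] [NormedAddCommGroup V] [InnerProductSpace ℂ V]
  {K : Subgroup G} {ρ : Representation ℂ G V}

theorem IsUnitaryRep.inner_apply_left (hρ : IsUnitaryRep ρ) (g : G) (v w : V) :
    inner ℂ (ρ g v) w = inner ℂ v (ρ g⁻¹ w) := by
  rw [← hρ g v (ρ g⁻¹ w), Representation.self_inv_apply]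

/-- A `K`-fixed vector `v` of a unitary representation gives the intertwiner
`u ↦ (gK ↦ ⟨u, ρ(g) v⟩)` to `L(G/K)`. -/
noncomputable def matrixCoeffMap (hρ : IsUnitaryRep ρ) (v : V) (hv : ∀ k ∈ K, ρ k v = v) :
    ρ.IntertwiningMap (permRep G (G ⧸ K)) where
  toFun u q := q.liftOn (fun g => inner ℂ (ρ g v) u) fun a b hab => by
    replace hab : a⁻¹ * b ∈ K := QuotientGroup.leftRel_apply.mp hab
    have : ρ b v = ρ a (ρ (a⁻¹ * b) v) := by
      rw [← Module.End.mul_apply, ← map_mul, mul_inv_cancel_left]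
    change inner ℂ (ρ a v) u = inner ℂ (ρ b v) u
    rw [this, hv _ hab]
  map_add' u w := by
    ext q
    induction q using Quotient.inductionOn with
    | h g => exact inner_add_right _ _ _
  map_smul' c u := by
    ext q
    induction q using Quotient.inductionOn with
    | h g => exact inner_smul_right _ _ _
  isIntertwining' g := by
    refine LinearMap.ext fun u => funext fun q => ?_
    induction q using Quotient.inductionOn with
    | h a =>
      change inner ℂ (ρ a v) (ρ g u) = inner ℂ (ρ (g⁻¹ * a) v) u
      rw [map_mul, Module.End.mul_apply, hρ.inner_apply_left g⁻¹, inv_inv]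

theorem matrixCoeffMap_one (hρ : IsUnitaryRep ρ) (v : V) (hv : ∀ k ∈ K, ρ k v = v) (u : V) :
    matrixCoeffMap hρ v hv u ((1 : G) : G ⧸ K) = inner ℂ v u := by
  change inner ℂ (ρ 1 v) u = inner ℂ v u
  rw [map_one, Module.End.one_apply]

variable [FiniteDimensional ℂ V]

/-- For a Gelfand pair, the `K`-fixed vectors of an irreducible unitary representation are
proportional. -/
theorem IsGelfandPair.exists_smul_eq (hK : IsGelfandPair K) (hρ : IsUnitaryRep ρ)
    (hirr : ρ.IsIrreducible) {v w : V} (hv0 : v ≠ 0) (hv : ∀ k ∈ K, ρ k v = v)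
    (hw : ∀ k ∈ K, ρ k w = w) : ∃ c : ℂ, w = c • v := by
  have hne : matrixCoeffMap hρ v hv ≠ 0 := by
    intro h
    have h1 := matrixCoeffMap_one hρ v hv v
    rw [h] at h1
    exact hv0 (inner_self_eq_zero.mp h1.symm)
  obtain ⟨c, hc⟩ := IsMultiplicityFree.exists_smul_eq hK hirr hne (matrixCoeffMap hρ w hw)
  -- The coefficient map is conjugate-linear in the fixed vector, hence the conjugate of `c`.
  refine ⟨starRingEnd ℂ c, ext_inner_right ℂ fun u => ?_⟩
  rw [← matrixCoeffMap_one hρ w hw u, hc, inner_smul_left, Complex.conj_conj,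
    ← matrixCoeffMap_one hρ v hv u]
  rfl

/-- Two `K`-fixed unit vectors differ by a scalar `c` with `|c| = 1`, which enters the matrix
coefficient only as `|c|²`. -/
theorem IsSphericalFunction.unique (hK : IsGelfandPair K) (hρ : IsUnitaryRep ρ)
    (hirr : ρ.IsIrreducible) {φ ψ : G → ℂ} (hφ : IsSphericalFunction K ρ φ)
    (hψ : IsSphericalFunction K ρ ψ) : φ = ψ := by
  obtain ⟨v, hv1, hv, hφ⟩ := hφ
  obtain ⟨w, hw1, hw, hψ⟩ := hψ
  obtain ⟨c, rfl⟩ := hK.exists_smul_eq hρ hirr (norm_ne_zero_iff.mp (by rw [hv1]; norm_num)) hv hw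
  have hc : ‖c‖ = 1 := by simpa [norm_smul, hv1] using hw1
  ext g
  rw [hφ, hψ, map_smul, inner_smul_left, inner_smul_right, ← mul_assoc,
    ← Complex.normSq_eq_conj_mul_self, Complex.normSq_eq_norm_sq, hc]
  simp

/-- A subrepresentation of `L(X)` has a unit vector fixed by the stabilizer of a point. -/
theorem exists_isSphericalFunction {X : Type*} [MulAction G X] [MulAction.IsPretransitive G X]
    (x₀ : X) (hx₀ : MulAction.stabilizer G x₀ = K) (hρ : IsUnitaryRep ρ) [Nontrivial V]
    (F : ρ.IntertwiningMap (permRep G X)) (hF : Function.Injective F) :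
    ∃ φ, IsSphericalFunction K ρ φ := by
  have := FiniteDimensional.complete ℂ V
  have hFg : ∀ g u, F (ρ g u) x₀ = F u (g⁻¹ • x₀) := fun g u => by
    rw [F.isIntertwining]
    rfl
  -- The fixed vector is the Riesz representative of evaluation at `x₀`. It is nonzero because, by
  -- transitivity, its vanishing would force `F = 0`.
  let l : V →ₗ[ℂ] ℂ := LinearMap.proj x₀ ∘ₗ F.toLinearMap
  let v := (InnerProductSpace.toDual ℂ V).symm (LinearMap.toContinuousLinearMap l)
  have hv : ∀ u, inner ℂ v u = F u x₀ := fun u => by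
    simp only [v, InnerProductSpace.toDual_symm_apply]
    rfl
  have hv0 : v ≠ 0 := by
    intro h0
    obtain ⟨u, hu⟩ := exists_ne (0 : V)
    refine hu (hF ?_)
    rw [map_zero]
    ext x
    obtain ⟨g, rfl⟩ := MulAction.exists_smul_eq G x₀ x
    have := hv (ρ g⁻¹ u)
    rw [h0, inner_zero_left, hFg, inv_inv] at this
    exact this.symm
  have hvK : ∀ k ∈ K, ρ k v = v := by
    intro k hk
    refine ext_inner_right ℂ fun u => ?_
    rw [hρ.inner_apply_left, hv, hv, hFg, inv_inv]
    rw [← hx₀, MulAction.mem_stabilizer_iff] at hk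
    rw [hk]
  refine ⟨_, ((‖v‖⁻¹ : ℝ) : ℂ) • v, ?_, fun k hk => ?_, fun g => rfl⟩
  · rw [norm_smul, Complex.norm_real, norm_inv, norm_norm,
      inv_mul_cancel₀ (norm_ne_zero_iff.mpr hv0)]
  · rw [map_smul, hvK k hk]

theorem IsSphericalFunction.sum_twist [Fintype G] {τ : G → G} (hτ : IsInvolutoryAntiAut τ)
    (hirr : ρ.IsIrreducible) {φ : G → ℂ} (hφ : IsSphericalFunction K ρ φ) :
    ((Module.finrank ℂ V : ℂ) / (Fintype.card G : ℂ)) * ∑ g : G, φ ((τ g)⁻¹ * g) =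
      (frobeniusSchur hτ ρ : ℂ) := by
  have := nontrivial_of_isIrreducible hirr
  have hd : (Module.finrank ℂ V : ℂ) ≠ 0 := by
    exact_mod_cast (Module.finrank_pos (R := ℂ) (M := V)).ne'
  have hG : (Fintype.card G : ℂ) ≠ 0 := by simp
  obtain ⟨v, hv1, -, hφ⟩ := hφ
  have h1 : ∑ g : G, φ ((τ g)⁻¹ * g) = inner ℂ (twistSum τ ρ v) v := by
    simp only [hφ, twistSum, LinearMap.sum_apply, sum_inner]
  rw [h1, twistSum_eq_smul hτ hirr, LinearMap.smul_apply, LinearMap.id_apply, inner_smul_left,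
    inner_self_eq_norm_sq_to_K, hv1]
  -- The scalar is real, so the conjugation coming from the first slot of `inner` has no effect.
  simp only [map_div₀, map_mul, map_natCast, map_intCast]
  field_simp
  simp

end Spherical

/-! ### The sum of squares via the trace of the squared twisted sum -/

section Sum

variable {G X I : Type*} [Group G] [Fintype G] [Fintype X] [MulAction G X]
  [MulAction.IsPretransitive G X] [Fintype I] {V : I → Type*} [∀ i, AddCommGroup (V i)]
  [∀ i, Module ℂ (V i)] [∀ i, FiniteDimensional ℂ (V i)]
  {ρ : ∀ i, Representation ℂ G (V i)} {τ : G → G}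

theorem sum_zeta_sq_eq_sum_frobeniusSchur_sq (hτ : IsInvolutoryAntiAut τ) (x₀ : X)
    (hirr : ∀ i, (ρ i).IsIrreducible) (e : (permRep G X).Equiv (Representation.directSum ρ)) :
    (Fintype.card X : ℂ) * ∑ x : X, (zeta τ x₀ x : ℂ) ^ 2 =
      (Fintype.card G : ℂ) ^ 2 *
        ∑ i, (frobeniusSchur hτ (ρ i) : ℂ) ^ 2 / Module.finrank ℂ (V i) := by
  classical
  rw [card_mul_sum_zeta_sq hτ]
  simp only [trace_eq_sum_of_equiv_directSum e]
  have hcomm : ∀ F : G → G → I → ℂ, ∑ g, ∑ h, ∑ i, F g h i = ∑ i, ∑ g, ∑ h, F g h i := by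
    intro F
    exact (Finset.sum_congr rfl fun g _ => Finset.sum_comm).trans Finset.sum_comm
  rw [hcomm, Finset.mul_sum]
  refine Finset.sum_congr rfl fun i _ => ?_
  have := nontrivial_of_isIrreducible (hirr i)
  have hd : (Module.finrank ℂ (V i) : ℂ) ≠ 0 := by
    exact_mod_cast (Module.finrank_pos (R := ℂ) (M := V i)).ne'
  have h1 : ∑ g : G, ∑ h : G, LinearMap.trace ℂ (V i) (ρ i (((τ g)⁻¹ * g) * ((τ h)⁻¹ * h))) =
      LinearMap.trace ℂ (V i) (twistSum τ (ρ i) * twistSum τ (ρ i)) := by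
    simp only [map_mul (ρ i) (_ * _) (_ * _), twistSum, Finset.sum_mul_sum, map_sum]
  rw [h1, twistSum_eq_smul hτ (hirr i), smul_mul_smul_comm, map_smul, ← Module.End.one_eq_id,
    one_mul, LinearMap.trace_one, smul_eq_mul]
  field_simp

theorem sum_zeta_sq_eq (hτ : IsInvolutoryAntiAut τ) (x₀ : X)
    (hirr : ∀ i, (ρ i).IsIrreducible) (e : (permRep G X).Equiv (Representation.directSum ρ))
    [DecidablePred fun i => Nonempty ((ρ i).Equiv (tauConj hτ (ρ i)))] :
    (1 / (Fintype.card G : ℝ)) * ∑ x : X, (zeta τ x₀ x : ℝ) ^ 2 =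
      (Nat.card (MulAction.stabilizer G x₀) : ℝ) *
        ∑ i ∈ Finset.univ.filter (fun i => Nonempty ((ρ i).Equiv (tauConj hτ (ρ i)))),
          1 / (Module.finrank ℂ (V i) : ℝ) := by
  have h := sum_zeta_sq_eq_sum_frobeniusSchur_sq hτ x₀ hirr e
  have h' : (Fintype.card X : ℝ) * ∑ x : X, (zeta τ x₀ x : ℝ) ^ 2 =
      (Fintype.card G : ℝ) ^ 2 *
        ∑ i, (frobeniusSchur hτ (ρ i) : ℝ) ^ 2 / Module.finrank ℂ (V i) := by exact_mod_cast h
  have hC : ∑ i ∈ Finset.univ.filter (fun i => Nonempty ((ρ i).Equiv (tauConj hτ (ρ i)))),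
      1 / (Module.finrank ℂ (V i) : ℝ) =
        ∑ i, (frobeniusSchur hτ (ρ i) : ℝ) ^ 2 / Module.finrank ℂ (V i) := by
    rw [Finset.sum_filter]
    refine Finset.sum_congr rfl fun i _ => ?_
    have : (frobeniusSchur hτ (ρ i) : ℝ) ^ 2 =
        if Nonempty ((ρ i).Equiv (tauConj hτ (ρ i))) then 1 else 0 := by
      exact_mod_cast frobeniusSchur_sq hτ (hirr i)
    rw [this]
    split_ifs <;> simp
  have hGX : (Fintype.card X : ℝ) * Nat.card (MulAction.stabilizer G x₀) = Fintype.card G := by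
    have := MulAction.index_stabilizer_of_transitive G x₀
    have h2 := Subgroup.index_mul_card (MulAction.stabilizer G x₀)
    rw [this, Nat.card_eq_fintype_card (α := X), Nat.card_eq_fintype_card (α := G)] at h2
    exact_mod_cast h2
  have hG : (Fintype.card G : ℝ) ≠ 0 := by simp
  have hX : (Fintype.card X : ℝ) ≠ 0 := fun h0 => hG (by rw [← hGX, h0, zero_mul])
  rw [hC]
  refine mul_left_cancel₀ hX ?_
  rw [mul_left_comm, h', ← mul_assoc (Fintype.card X : ℝ), hGX]
  field_simp

end Sum

end TwistedFS

open TwistedFS in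
open scoped Classical in
theorem theorem9p1 {G X I : Type*} [Group G] [Fintype G] [Fintype X] [MulAction G X]
    [MulAction.IsPretransitive G X] (x₀ : X) (K : Subgroup G)
    (hK : MulAction.stabilizer G x₀ = K) (hGK : IsGelfandPair K)
    -- the decomposition of `L(X)` into irreducible unitary representations `ρ i`
    [Fintype I] (V : I → Type*) [∀ i, NormedAddCommGroup (V i)]
    [∀ i, InnerProductSpace ℂ (V i)] [∀ i, FiniteDimensional ℂ (V i)]
    (ρ : ∀ i, Representation ℂ G (V i)) (hunit : ∀ i, IsUnitaryRep (ρ i))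
    (hirr : ∀ i, (ρ i).IsIrreducible)
    (hdec : Nonempty ((permRep G X).Equiv (Representation.directSum ρ)))
    (τ : G → G) (hτ : IsInvolutoryAntiAut τ) :
    (∀ i, (∃! φ : G → ℂ, IsSphericalFunction K (ρ i) φ) ∧
      ∀ φ : G → ℂ, IsSphericalFunction K (ρ i) φ →
        ((Module.finrank ℂ (V i) : ℂ) / (Fintype.card G : ℂ)) * ∑ g : G, φ ((τ g)⁻¹ * g) =
          (frobeniusSchur hτ (ρ i) : ℂ)) ∧
    (1 / (Fintype.card G : ℝ)) * ∑ x : X, (zeta τ x₀ x : ℝ) ^ 2 =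
      (Nat.card K : ℝ) *
        ∑ i ∈ Finset.univ.filter (fun i => Nonempty ((ρ i).Equiv (tauConj hτ (ρ i)))),
          1 / (Module.finrank ℂ (V i) : ℝ) := by
  obtain ⟨e⟩ := hdec
  refine ⟨fun i => ⟨?_, fun φ hφ => hφ.sum_twist hτ (hirr i)⟩, ?_⟩
  · have := nontrivial_of_isIrreducible (hirr i)
    -- The inclusion of the `i`-th summand realizes `ρ i` inside `L(X)`, where evaluation at `x₀` is
    -- available.
    let F : (ρ i).IntertwiningMap (permRep G X) := e.symm.toIntertwiningMap.comp
      ⟨DirectSum.lof ℂ I V i, fun g => by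
        ext v
        simp⟩
    have hF : Function.Injective F := e.symm.toLinearEquiv.injective.comp (DirectSum.of_injective i)
    obtain ⟨φ, hφ⟩ := exists_isSphericalFunction x₀ hK (hunit i) F hF
    exact ⟨φ, hφ, fun ψ hψ => hψ.unique hGK (hunit i) (hirr i) hφ⟩
  · subst hK
    exact sum_zeta_sq_eq hτ x₀ hirr e
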